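/- Let $\ell\ge 1$ be an integer (the emission size), and let $(u_i^0)_{i\ge1}$ be nonnegative real numbers with $\sum_{i\ge1}u_i^0=1$. Assume that the data are large, i.e. $u_i^0=0$ for $i\le\ell$, and have bounded support, i.e. there is $L\ge\ell+1$ with $u_i^0=0$ for $i>L$. A large-cluster solution on $[0,T]$ is a family $(u_n)_{n\ge\ell+1}$ of functions in $C^1([0,T],[0,1])$ with $u_n(0)=u_n^0$, whose first moment $m_1(t)=\sum_{i\ge\ell+1}i\,u_i(t)$ is finite and positive on $[0,T]$ and which satisfies, for all $n\ge\ell+1$ and $t\in[0,T]$, $$\dot u_n=\sum_{i=\ell+1}^{n-1}\frac{i(n+\ell-i)}{m_1(t)^2}\,u_iu_{n+\ell-i}-\frac{2n\,u_n}{m_1(t)}$$ (the sum is $0$ for $n=\ell+1$; derivatives at the endpoints are one-sided). It is pre-gelation if, extended by $u_n=0$ for $1\le n\le\ell$, it solves the full kinetic equations $$\dot u_n=\sum_{i=1}^{n+\ell-1}\frac{i(n+\ell-i)}{M}\,u_iu_{n+\ell-i}-2nu_n\sum_{i\ge\max(1+\ell-n,\,1)}\frac{i\,u_i}{M},\qquad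 M=\sum_{i+j\ge\ell+1}ij\,u_iu_j,\qquad n\ge1,$$ with $0<M<\infty$ on $[0,T]$, and its second moment $m_2(t)=\sum_{i}i^2u_i(t)$ converges uniformly for $t\in[0,T]$. Then there is $T>0$ such that there exists a pre-gelation large-cluster solution $(u_n)_{n\ge\ell+1}$ on $[0,T]$ with initial data $(u_n^0)$. It is unique: every large-cluster solution $(v_n)_{n\ge\ell+1}$ on $[0,T]$ with the same initial data and with second moment uniformly convergent on $[0,T]$ satisfies $v_n=u_n$ on $[0,T]$ for all $n\ge\ell+1$. Moreover $u_n\in C^\infty([0,T],[0,1])$ for every $n\ge\ell+1$. -/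

import Mathlib

open Set Filter Topology

open scoped ContDiff

noncomputable section

namespace EmissionCoagulation

/-! Cluster fractions are families `u : ℕ → ℝ → ℝ`; `u n t` is the fraction of clusters of `n`
particles at time `t`. Sizes are the integers `n ≥ 1`: the index `0` never enters the equations,
nor the moments of order `k ≥ 1`. The emission size is `ℓ`. -/

/-- The `k`-th moment `∑_{i ≥ 1} i ^ k u_i(t)` (used for `k ≥ 1` only). -/
def moment (k : ℕ) (u : ℕ → ℝ → ℝ) (t : ℝ) : ℝ :=
  ∑' i : ℕ, (i : ℝ) ^ k * u i t

/-- The series defining the `k`-th moment converges uniformly on `[0, T]`. -/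
def MomentConvergesUniformly (k : ℕ) (T : ℝ) (u : ℕ → ℝ → ℝ) : Prop :=
  TendstoUniformlyOn (fun (N : ℕ) (t : ℝ) => ∑ i ∈ Finset.range N, (i : ℝ) ^ k * u i t)
    (moment k u) atTop (Icc 0 T)

/-- The terms of the series `M = ∑_{i + j ≥ ℓ + 1} i j u_i u_j`. -/
def collisionTerm (ℓ : ℕ) (u : ℕ → ℝ → ℝ) (t : ℝ) (p : ℕ × ℕ) : ℝ :=
  if ℓ + 1 ≤ p.1 + p.2 then (p.1 : ℝ) * (p.2 : ℝ) * u p.1 t * u p.2 t else 0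

/-- The normalization `M = ∑_{i + j ≥ ℓ + 1} i j u_i u_j` over all pairs that may react. -/
def collisionMass (ℓ : ℕ) (u : ℕ → ℝ → ℝ) (t : ℝ) : ℝ :=
  ∑' p : ℕ × ℕ, collisionTerm ℓ u t p

/-- Right-hand side of the kinetic equation for `n`-clusters, all cluster sizes being allowed:
`∑_{i=1}^{n+ℓ-1} i (n+ℓ-i) u_i u_{n+ℓ-i} / M - 2 n u_n ∑_{i ≥ max (1+ℓ-n) 1} i u_i / M`. -/
def kineticRHS (ℓ : ℕ) (u : ℕ → ℝ → ℝ) (n : ℕ) (t : ℝ) : ℝ :=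
  (∑ i ∈ Finset.Icc 1 (n + ℓ - 1),
      (i : ℝ) * ((n + ℓ - i : ℕ) : ℝ) / collisionMass ℓ u t * u i t * u (n + ℓ - i) t)
    - 2 * (n : ℝ) * u n t *
      ∑' i : ℕ, if max (1 + ℓ - n) 1 ≤ i then (i : ℝ) * u i t / collisionMass ℓ u t else 0

/-- A nonnegative solution on `[0, T]` of the kinetic equations with initial data `u₀`. The fields
`summable_mass`, `summable_collision` and `collisionMass_pos` say that the right-hand side of the
equations is meaningful. -/
structure IsKineticSolution (ℓ : ℕ) (u₀ : ℕ → ℝ) (T : ℝ) (u : ℕ → ℝ → ℝ) : Prop where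
  nonneg : ∀ n : ℕ, 1 ≤ n → ∀ t ∈ Icc 0 T, 0 ≤ u n t
  summable_mass : ∀ t ∈ Icc 0 T, Summable fun i : ℕ => (i : ℝ) * u i t
  summable_collision : ∀ t ∈ Icc 0 T, Summable (collisionTerm ℓ u t)
  collisionMass_pos : ∀ t ∈ Icc 0 T, 0 < collisionMass ℓ u t
  hasDeriv : ∀ n : ℕ, 1 ≤ n → ∀ t ∈ Icc 0 T,
    HasDerivWithinAt (u n) (kineticRHS ℓ u n t) (Icc 0 T) t
  init : ∀ n : ℕ, 1 ≤ n → u n 0 = u₀ n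

/-- A pre-gelation solution on `[0, T]`: a nonnegative solution of the kinetic equations whose
second moment converges uniformly on `[0, T]`. -/
structure IsPreGelationSolution (ℓ : ℕ) (u₀ : ℕ → ℝ) (T : ℝ) (u : ℕ → ℝ → ℝ) : Prop where
  isSolution : IsKineticSolution ℓ u₀ T u
  secondMoment : MomentConvergesUniformly 2 T u

/-- Right-hand side of the large-cluster equation for `n`-clusters, `n ≥ ℓ + 1`:
`∑_{i=ℓ+1}^{n-1} i (n+ℓ-i) u_i u_{n+ℓ-i} / m₁ ^ 2 - 2 n u_n / m₁`. -/
def largeRHS (ℓ : ℕ) (u : ℕ → ℝ → ℝ) (n : ℕ) (t : ℝ) : ℝ :=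
  (∑ i ∈ Finset.Ico (ℓ + 1) n,
      (i : ℝ) * ((n + ℓ - i : ℕ) : ℝ) / (moment 1 u t) ^ 2 * u i t * u (n + ℓ - i) t)
    - 2 * (n : ℝ) * u n t / moment 1 u t

/-- A large-cluster solution `(u_{ℓ+1}, u_{ℓ+2}, …)` on `[0, T]` with initial data `u₀`, written as
a family over all sizes that is extended by zero to the sizes `n ≤ ℓ`: each `u n` is a `C¹`
function from `[0, T]` to `[0, 1]` and the large-cluster equations hold. The fields
`summable_mass` and `mass_pos` say that the right-hand side is meaningful. -/
structure IsLargeClusterSolution (ℓ : ℕ) (u₀ : ℕ → ℝ) (T : ℝ) (u : ℕ → ℝ → ℝ) : Prop where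
  zero_of_le : ∀ n : ℕ, n ≤ ℓ → ∀ t ∈ Icc 0 T, u n t = 0
  contDiffOn : ∀ n : ℕ, ℓ + 1 ≤ n → ContDiffOn ℝ 1 (u n) (Icc 0 T)
  mapsTo : ∀ n : ℕ, ℓ + 1 ≤ n → MapsTo (u n) (Icc 0 T) (Icc 0 1)
  summable_mass : ∀ t ∈ Icc 0 T, Summable fun i : ℕ => (i : ℝ) * u i t
  mass_pos : ∀ t ∈ Icc 0 T, 0 < moment 1 u t
  hasDeriv : ∀ n : ℕ, ℓ + 1 ≤ n → ∀ t ∈ Icc 0 T,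
    HasDerivWithinAt (u n) (largeRHS ℓ u n t) (Icc 0 T) t
  init : ∀ n : ℕ, ℓ + 1 ≤ n → u n 0 = u₀ n

end EmissionCoagulation

end

/-! The nonlinearity enters only through $m_1$, and $m_1$ is known in advance. Weighting the
equations by $n$ and summing, the gain contributes $(2m_2m_1-\ell m_1^2)/m_1^2$ and the loss
$-2m_2/m_1$, so $\dot m_1=-\ell$. Uniform convergence of $m_2$ justifies the exchange of sum and
integral (`hasSum_mul_sub`). Hence $m_1(t)=m_1(0)-\ell t$ for every admissible solution
(`moment_one_eq`).

Replace $m_1$ by this affine function $c$. The system becomes triangular: the gain of size $n$ uses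
only sizes in $[\ell+1,n-1]$, so each equation is linear in $u_n$ and variation of constants solves
it, preserving nonnegativity. Such a solution is unique (`eqOn`) and smooth (`contDiffOn`). It
solves the original system once $m_1=c$, which holds because $m_1-c$ satisfies a homogeneous linear
equation (`moment_one_eq_coeff`).

The remaining issue is control of $m_2$. The profile $Ae^{(-2+\kappa t)n}/n^3$ is a supersolution
for a short time (`le_exp_of_hasDerivWithinAt`), because $1/n^2$ is stable under convolution up to a
constant. -/

namespace EmissionCoagulation

/-! ### Scalar linear differential equations on a compact interval -/

section LinearODE

variable {T : ℝ}

theorem hasDerivWithinAt_Ici_of_Icc {f : ℝ → ℝ} {f' t : ℝ}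
    (h : HasDerivWithinAt f f' (Icc 0 T) t) (ht : t ∈ Ico 0 T) :
    HasDerivWithinAt f f' (Ici t) t :=
  h.mono_of_mem_nhdsWithin (Icc_mem_nhdsGE_of_mem ht)

/-- A solution of a homogeneous linear equation with bounded coefficient that starts at zero
vanishes. -/
theorem eqOn_zero_of_hasDerivWithinAt_mul {w a : ℝ → ℝ} (ha : ContinuousOn a (Icc 0 T))
    (hw : ∀ t ∈ Icc 0 T, HasDerivWithinAt w (a t * w t) (Icc 0 T) t) (h0 : w 0 = 0) :
    ∀ t ∈ Icc 0 T, w t = 0 := by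
  obtain ⟨K, hK⟩ := isCompact_Icc.exists_bound_of_continuousOn ha
  intro t ht
  have key := norm_le_gronwallBound_of_norm_deriv_right_le (f := w) (δ := 0) (K := K) (ε := 0)
    (fun t ht => (hw t ht).continuousWithinAt)
    (fun t ht => hasDerivWithinAt_Ici_of_Icc (hw t (Ico_subset_Icc_self ht)) ht)
    (by simp [h0])
    (fun t ht => by
      rw [norm_mul, add_zero]
      exact mul_le_mul_of_nonneg_right (hK t (Ico_subset_Icc_self ht)) (norm_nonneg _)) t ht
  rw [gronwallBound_ε0_δ0] at key
  exact norm_le_zero_iff.1 key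

theorem le_of_hasDerivWithinAt_le {f f' g g' : ℝ → ℝ}
    (hf : ∀ t ∈ Icc 0 T, HasDerivWithinAt f (f' t) (Icc 0 T) t)
    (hg : ∀ t ∈ Icc 0 T, HasDerivWithinAt g (g' t) (Icc 0 T) t) (h0 : f 0 ≤ g 0)
    (h : ∀ t ∈ Icc 0 T, f' t ≤ g' t) : ∀ t ∈ Icc 0 T, f t ≤ g t := by
  intro t ht
  refine image_le_of_deriv_right_le_deriv_boundary
    (fun t ht => (hf t ht).continuousWithinAt)
    (fun t ht => hasDerivWithinAt_Ici_of_Icc (hf t (Ico_subset_Icc_self ht)) ht) h0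
    (fun t ht => (hg t ht).continuousWithinAt)
    (fun t ht => hasDerivWithinAt_Ici_of_Icc (hg t (Ico_subset_Icc_self ht)) ht)
    (fun t ht => h t (Ico_subset_Icc_self ht)) ht

theorem hasDerivWithinAt_integral_of_continuousOn {f : ℝ → ℝ} (hf : ContinuousOn f (Icc 0 T))
    {t : ℝ} (ht : t ∈ Icc 0 T) :
    HasDerivWithinAt (fun s => ∫ x in (0 : ℝ)..s, f x) (f t) (Icc 0 T) t := by
  have : Fact (t ∈ Icc 0 T) := ⟨ht⟩
  refine intervalIntegral.integral_hasDerivWithinAt_right ?_ ?_ (hf t ht)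
  · refine (hf.mono ?_).intervalIntegrable
    rw [uIcc_of_le ht.1]
    exact Icc_subset_Icc_right ht.2
  · exact hf.stronglyMeasurableAtFilter_nhdsWithin measurableSet_Icc t

/-- The solution of `w' = f - a w`, `w 0 = x`, by variation of constants. -/
noncomputable def linearSolution (a f : ℝ → ℝ) (x t : ℝ) : ℝ :=
  Real.exp (-∫ s in (0 : ℝ)..t, a s) *
    (x + ∫ s in (0 : ℝ)..t, Real.exp (∫ r in (0 : ℝ)..s, a r) * f s)

theorem linearSolution_zero (a f : ℝ → ℝ) (x : ℝ) : linearSolution a f x 0 = x := by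
  simp [linearSolution]

theorem hasDerivWithinAt_linearSolution {a f : ℝ → ℝ} (ha : ContinuousOn a (Icc 0 T))
    (hf : ContinuousOn f (Icc 0 T)) (x : ℝ) {t : ℝ} (ht : t ∈ Icc 0 T) :
    HasDerivWithinAt (linearSolution a f x) (f t - a t * linearSolution a f x t) (Icc 0 T) t := by
  have hA := fun {s : ℝ} (hs : s ∈ Icc 0 T) => hasDerivWithinAt_integral_of_continuousOn ha hs
  have hE : ContinuousOn (fun s => Real.exp (∫ r in (0 : ℝ)..s, a r) * f s) (Icc 0 T) :=
    ContinuousOn.mul (fun s hs => (hA hs).continuousWithinAt.rexp) hf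
  have := (hA ht).neg.exp.mul ((hasDerivWithinAt_integral_of_continuousOn hE ht).const_add x)
  refine this.congr_deriv ?_
  have h1 : Real.exp (-∫ s in (0 : ℝ)..t, a s) * Real.exp (∫ s in (0 : ℝ)..t, a s) = 1 := by
    rw [← Real.exp_add]; simp
  simp only [linearSolution, Pi.neg_apply]
  linear_combination f t * h1

theorem linearSolution_nonneg {a f : ℝ → ℝ} {x : ℝ} (hx : 0 ≤ x)
    (hf : ∀ t ∈ Icc 0 T, 0 ≤ f t) {t : ℝ} (ht : t ∈ Icc 0 T) : 0 ≤ linearSolution a f x t := by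
  refine mul_nonneg (Real.exp_nonneg _) (add_nonneg hx ?_)
  refine intervalIntegral.integral_nonneg ht.1 fun s hs => ?_
  exact mul_nonneg (Real.exp_nonneg _) (hf s ⟨hs.1, hs.2.trans ht.2⟩)

end LinearODE

/-! ### Convolutions shifted by the emission size -/

section ConvolutionSums

/-- Outside the smaller range one factor has index at most `ℓ`: the first if `i ≤ ℓ`, the second if
`n ≤ i`. -/
theorem sum_antidiagonal_add_eq_sum_Ico {ℓ : ℕ} {f : ℕ → ℝ} (hf : ∀ i ≤ ℓ, f i = 0) (n : ℕ) :
    ∑ p ∈ Finset.HasAntidiagonal.antidiagonal (n + ℓ), f p.1 * f p.2 =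
      ∑ i ∈ Finset.Ico (ℓ + 1) n, f i * f (n + ℓ - i) := by
  rw [Finset.Nat.sum_antidiagonal_eq_sum_range_succ (fun i j => f i * f j)]
  symm
  refine Finset.sum_subset (fun i hi => ?_) fun i hi hi' => ?_
  · simp only [Finset.mem_Ico, Finset.mem_range] at *
    omega
  · simp only [Finset.mem_Ico, Finset.mem_range, not_and, not_lt] at *
    by_cases h : i ≤ ℓ
    · rw [hf i h, zero_mul]
    · rw [hf (n + ℓ - i) (by have := hi' (by omega); omega), mul_zero]

theorem hasSum_sum_antidiagonal {f g : ℕ → ℝ} {a b : ℝ} (hf0 : ∀ i, 0 ≤ f i)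
    (hg0 : ∀ i, 0 ≤ g i) (hf : HasSum f a) (hg : HasSum g b) :
    HasSum (fun n => ∑ p ∈ Finset.HasAntidiagonal.antidiagonal n, f p.1 * g p.2) (a * b) := by
  have h := hf.summable.mul_of_nonneg hg.summable hf0 hg0
  have h1 := (summable_sum_mul_antidiagonal_of_summable_mul h).hasSum
  rwa [← hf.summable.tsum_mul_tsum_eq_tsum_sum_antidiagonal hg.summable h, hf.tsum_eq,
    hg.tsum_eq] at h1

theorem hasSum_nat_add_of_eq_zero {g : ℕ → ℝ} {a : ℝ} {ℓ : ℕ} (hg : HasSum g a)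
    (h : ∀ n < ℓ, g n = 0) : HasSum (fun n => g (n + ℓ)) a := by
  rw [hasSum_nat_add_iff, Finset.sum_eq_zero fun i hi => h i (Finset.mem_range.1 hi), add_zero]
  exact hg

theorem sum_antidiagonal_eq_zero_of_lt {ℓ : ℕ} {f : ℕ → ℝ} (hf : ∀ i ≤ ℓ, f i = 0) {n : ℕ}
    (hn : n < ℓ) : ∑ p ∈ Finset.HasAntidiagonal.antidiagonal n, f p.1 * f p.2 = 0 := by
  refine Finset.sum_eq_zero fun p hp => ?_
  rw [Finset.HasAntidiagonal.mem_antidiagonal] at hp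
  rw [hf p.1 (by omega), zero_mul]

theorem hasSum_convolution {ℓ : ℕ} {f : ℕ → ℝ} {a : ℝ} (hf0 : ∀ i, 0 ≤ f i)
    (hf : ∀ i ≤ ℓ, f i = 0) (ha : HasSum f a) :
    HasSum (fun n => ∑ i ∈ Finset.Ico (ℓ + 1) n, f i * f (n + ℓ - i)) (a ^ 2) := by
  have h := hasSum_nat_add_of_eq_zero (ℓ := ℓ) (hasSum_sum_antidiagonal hf0 hf0 ha ha)
    fun n hn => sum_antidiagonal_eq_zero_of_lt hf hn
  rw [← pow_two] at h
  exact h.congr_fun fun n => (sum_antidiagonal_add_eq_sum_Ico hf n).symm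

/-- With `j = n + ℓ - i`, the weight splits as `n = i + j - ℓ`. The parts `i` and `j` each give `b *
a`, and the shift costs `ℓ * a ^ 2`. -/
theorem hasSum_mul_convolution {ℓ : ℕ} {f : ℕ → ℝ} {a b : ℝ} (hf0 : ∀ i, 0 ≤ f i)
    (hf : ∀ i ≤ ℓ, f i = 0) (ha : HasSum f a) (hb : HasSum (fun i : ℕ => (i : ℝ) * f i) b) :
    HasSum (fun n : ℕ => (n : ℝ) * ∑ i ∈ Finset.Ico (ℓ + 1) n, f i * f (n + ℓ - i))
      (2 * b * a - ℓ * a ^ 2) := by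
  have hif0 : ∀ i : ℕ, 0 ≤ (i : ℝ) * f i := fun i => mul_nonneg i.cast_nonneg (hf0 i)
  have h1 := (hasSum_sum_antidiagonal hif0 hf0 hb ha).add
    (hasSum_sum_antidiagonal hf0 hif0 ha hb)
  have h2 : HasSum (fun n : ℕ => (n : ℝ) * ∑ p ∈ Finset.HasAntidiagonal.antidiagonal n, f p.1 * f p.2)
      (2 * b * a) := by
    convert h1 using 1
    · funext n
      rw [Finset.mul_sum, ← Finset.sum_add_distrib]
      refine Finset.sum_congr rfl fun p hp => ?_
      rw [Finset.HasAntidiagonal.mem_antidiagonal] at hp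
      rw [← hp]
      push_cast
      ring
    · ring
  have h3 := hasSum_nat_add_of_eq_zero (ℓ := ℓ) h2 fun n hn => by
    rw [sum_antidiagonal_eq_zero_of_lt hf hn, mul_zero]
  refine (h3.sub ((hasSum_convolution hf0 hf ha).mul_left (ℓ : ℝ))).congr_fun ?_
  intro n
  simp only [sum_antidiagonal_add_eq_sum_Ico hf]
  push_cast
  ring

/-- The sequence `i ↦ 1 / i ^ 2` reproduces itself under convolution. -/
theorem sum_inv_sq_mul_inv_sq_le (ℓ n : ℕ) :
    ∑ i ∈ Finset.Ico (ℓ + 1) n, ((i : ℝ) ^ 2)⁻¹ * (((n + ℓ - i : ℕ) : ℝ) ^ 2)⁻¹ ≤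
      8 * (((n + ℓ : ℕ) : ℝ) ^ 2)⁻¹ := by
  have hS : ∑ i ∈ Finset.Ico (ℓ + 1) n, ((i : ℝ) ^ 2)⁻¹ ≤ 2 := by
    have h := sum_Ioo_inv_sq_le (α := ℝ) ℓ n
    have h2 : Finset.Ioo ℓ n = Finset.Ico (ℓ + 1) n := by
      ext; simp
    rw [h2] at h
    refine h.trans ?_
    rw [div_le_iff₀ (by positivity)]
    have : (0 : ℝ) ≤ ℓ := ℓ.cast_nonneg
    linarith
  -- The reflection `i ↦ n + ℓ - i` permutes the index range.
  have hR : ∑ i ∈ Finset.Ico (ℓ + 1) n, (((n + ℓ - i : ℕ) : ℝ) ^ 2)⁻¹ =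
      ∑ i ∈ Finset.Ico (ℓ + 1) n, ((i : ℝ) ^ 2)⁻¹ := by
    refine Finset.sum_nbij' (fun i => n + ℓ - i) (fun i => n + ℓ - i) ?_ ?_ ?_ ?_ ?_ <;>
      intro i hi <;> simp only [Finset.mem_Ico] at * <;> omega
  -- This is `(i + j) ^ 2 ≤ 2 * (i ^ 2 + j ^ 2)` divided by the squares. The two sums on the right
  -- are at most `2` each, whence `8 = 2 * (2 + 2)`.
  have hle : ∀ i ∈ Finset.Ico (ℓ + 1) n, ((i : ℝ) ^ 2)⁻¹ * (((n + ℓ - i : ℕ) : ℝ) ^ 2)⁻¹ ≤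
      2 * (((n + ℓ : ℕ) : ℝ) ^ 2)⁻¹ *
        (((i : ℝ) ^ 2)⁻¹ + (((n + ℓ - i : ℕ) : ℝ) ^ 2)⁻¹) := by
    intro i hi
    rw [Finset.mem_Ico] at hi
    obtain ⟨j, hj⟩ : ∃ j, j = n + ℓ - i := ⟨_, rfl⟩
    have hij : n + ℓ = i + j := by omega
    rw [← hj, hij]
    have hi0 : (0 : ℝ) < i := by exact_mod_cast (by omega : 0 < i)
    have hj0 : (0 : ℝ) < j := by exact_mod_cast (by omega : 0 < j)
    push_cast
    have e : 2 * (((i : ℝ) + j) ^ 2)⁻¹ * (((i : ℝ) ^ 2)⁻¹ + ((j : ℝ) ^ 2)⁻¹) =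
        (((i : ℝ) ^ 2)⁻¹ * ((j : ℝ) ^ 2)⁻¹) * (2 * (i ^ 2 + j ^ 2) / (i + j) ^ 2) := by
      field_simp
      ring
    rw [e]
    refine le_mul_of_one_le_right (by positivity) ?_
    rw [one_le_div (by positivity)]
    nlinarith [sq_nonneg ((i : ℝ) - j)]
  refine (Finset.sum_le_sum hle).trans ?_
  rw [← Finset.mul_sum, Finset.sum_add_distrib, hR]
  have : (0 : ℝ) ≤ (((n + ℓ : ℕ) : ℝ) ^ 2)⁻¹ := by positivity
  nlinarith

end ConvolutionSums

/-! ### The system with prescribed coefficient, and its moments -/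

/-- The rate at which `n`-clusters are formed, before normalization. -/
noncomputable def gain (ℓ : ℕ) (u : ℕ → ℝ → ℝ) (n : ℕ) (t : ℝ) : ℝ :=
  ∑ i ∈ Finset.Ico (ℓ + 1) n, (i : ℝ) * u i t * (((n + ℓ - i : ℕ) : ℝ) * u (n + ℓ - i) t)

theorem largeRHS_eq (ℓ : ℕ) (u : ℕ → ℝ → ℝ) (n : ℕ) (t : ℝ) :
    largeRHS ℓ u n t = gain ℓ u n t / moment 1 u t ^ 2 - 2 * n * u n t / moment 1 u t := by
  rw [largeRHS, gain, Finset.sum_div]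
  congr 1
  refine Finset.sum_congr rfl fun i _ => ?_
  ring

theorem gain_eq_zero_of_le {ℓ : ℕ} (u : ℕ → ℝ → ℝ) {n : ℕ} (hn : n ≤ ℓ) (t : ℝ) :
    gain ℓ u n t = 0 := by
  rw [gain, Finset.Ico_eq_empty (by omega), Finset.sum_empty]

/-- A nonnegative solution of the large-cluster equations in which the first moment is replaced by
a prescribed function `c`. -/
structure IsReducedSolution (ℓ : ℕ) (T : ℝ) (c : ℝ → ℝ) (u : ℕ → ℝ → ℝ) : Prop where
  zero_of_le : ∀ n : ℕ, n ≤ ℓ → ∀ t ∈ Icc 0 T, u n t = 0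
  nonneg : ∀ n : ℕ, ∀ t ∈ Icc 0 T, 0 ≤ u n t
  secondMoment : MomentConvergesUniformly 2 T u
  continuousOn_coeff : ContinuousOn c (Icc 0 T)
  coeff_pos : ∀ t ∈ Icc 0 T, 0 < c t
  hasDeriv : ∀ n : ℕ, ∀ t ∈ Icc 0 T,
    HasDerivWithinAt (u n) (gain ℓ u n t / c t ^ 2 - 2 * n * u n t / c t) (Icc 0 T) t

section Moments

variable {T : ℝ} {u : ℕ → ℝ → ℝ}

theorem MomentConvergesUniformly.hasSum {k : ℕ} (h : MomentConvergesUniformly k T u)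
    (hu : ∀ n : ℕ, ∀ t ∈ Icc 0 T, 0 ≤ u n t) {t : ℝ} (ht : t ∈ Icc 0 T) :
    HasSum (fun i : ℕ => (i : ℝ) ^ k * u i t) (moment k u t) :=
  (hasSum_iff_tendsto_nat_of_nonneg
    (fun i => mul_nonneg (pow_nonneg i.cast_nonneg k) (hu i t ht)) _).2 (h.tendsto_at ht)

theorem MomentConvergesUniformly.continuousOn {k : ℕ} (h : MomentConvergesUniformly k T u)
    (hu : ∀ n : ℕ, ContinuousOn (u n) (Icc 0 T)) : ContinuousOn (moment k u) (Icc 0 T) :=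
  TendstoUniformlyOn.continuousOn h <| Frequently.of_forall fun _ =>
    continuousOn_finsetSum _ fun i _ => (hu i).const_mul _

theorem cast_mul_le_cast_sq_mul (i : ℕ) {x : ℝ} (hx : 0 ≤ x) :
    (i : ℝ) ^ 1 * x ≤ (i : ℝ) ^ 2 * x := by
  refine mul_le_mul_of_nonneg_right ?_ hx
  rcases Nat.eq_zero_or_pos i with rfl | hi
  · simp
  · exact pow_le_pow_right₀ (by exact_mod_cast hi) (by norm_num)

/-- The terms are nonnegative, so each tail of the first moment is dominated by the same tail of the
second. -/
theorem MomentConvergesUniformly.first_of_second (h : MomentConvergesUniformly 2 T u)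
    (hu : ∀ n : ℕ, ∀ t ∈ Icc 0 T, 0 ≤ u n t) : MomentConvergesUniformly 1 T u := by
  unfold MomentConvergesUniformly at h ⊢
  have h' := h
  rw [Metric.tendstoUniformlyOn_iff] at h ⊢
  intro ε hε
  filter_upwards [h ε hε] with N hN t ht
  have hs2 := (MomentConvergesUniformly.hasSum h' hu ht).summable
  have hs1 : Summable fun i : ℕ => (i : ℝ) ^ 1 * u i t :=
    hs2.of_nonneg_of_le (fun i => mul_nonneg (by positivity) (hu i t ht))
      fun i => cast_mul_le_cast_sq_mul i (hu i t ht)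
  refine lt_of_le_of_lt ?_ (hN t ht)
  rw [moment, moment, ← hs1.sum_add_tsum_nat_add N, ← hs2.sum_add_tsum_nat_add N, Real.dist_eq,
    Real.dist_eq, add_sub_cancel_left, add_sub_cancel_left,
    abs_of_nonneg (tsum_nonneg fun i => mul_nonneg (by positivity) (hu _ t ht))]
  refine le_trans ?_ (le_abs_self _)
  exact Summable.tsum_le_tsum (fun i => cast_mul_le_cast_sq_mul _ (hu _ t ht))
    ((summable_nat_add_iff N).2 hs1) ((summable_nat_add_iff N).2 hs2)

end Moments

namespace IsReducedSolution

variable {ℓ : ℕ} {T : ℝ} {c : ℝ → ℝ} {u : ℕ → ℝ → ℝ} {t : ℝ}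

theorem continuousOn (h : IsReducedSolution ℓ T c u) (n : ℕ) : ContinuousOn (u n) (Icc 0 T) :=
  fun t ht => (h.hasDeriv n t ht).continuousWithinAt

theorem continuousOn_gain (h : IsReducedSolution ℓ T c u) (n : ℕ) :
    ContinuousOn (gain ℓ u n) (Icc 0 T) :=
  continuousOn_finsetSum _ fun i _ =>
    ((h.continuousOn i).const_mul _).mul ((h.continuousOn _).const_mul _)

theorem gain_nonneg (h : IsReducedSolution ℓ T c u) (n : ℕ) (ht : t ∈ Icc 0 T) :
    0 ≤ gain ℓ u n t :=
  Finset.sum_nonneg fun i _ => mul_nonneg (mul_nonneg i.cast_nonneg (h.nonneg i t ht))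
    (mul_nonneg (Nat.cast_nonneg _) (h.nonneg _ t ht))

theorem continuousOn_moment_two (h : IsReducedSolution ℓ T c u) :
    ContinuousOn (moment 2 u) (Icc 0 T) :=
  h.secondMoment.continuousOn h.continuousOn

theorem continuousOn_moment_one (h : IsReducedSolution ℓ T c u) :
    ContinuousOn (moment 1 u) (Icc 0 T) :=
  (h.secondMoment.first_of_second h.nonneg).continuousOn h.continuousOn

theorem hasSum_moment_one (h : IsReducedSolution ℓ T c u) (ht : t ∈ Icc 0 T) :
    HasSum (fun i : ℕ => (i : ℝ) * u i t) (moment 1 u t) := by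
  simpa only [pow_one] using (h.secondMoment.first_of_second h.nonneg).hasSum h.nonneg ht

theorem hasSum_moment_two (h : IsReducedSolution ℓ T c u) (ht : t ∈ Icc 0 T) :
    HasSum (fun i : ℕ => (i : ℝ) * (i * u i t)) (moment 2 u t) := by
  simpa only [pow_two, mul_assoc] using h.secondMoment.hasSum h.nonneg ht

theorem hasSum_gain (h : IsReducedSolution ℓ T c u) (ht : t ∈ Icc 0 T) :
    HasSum (fun n : ℕ => gain ℓ u n t) (moment 1 u t ^ 2) :=
  hasSum_convolution (fun i => mul_nonneg i.cast_nonneg (h.nonneg i t ht))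
    (fun i hi => by rw [h.zero_of_le i hi t ht, mul_zero]) (h.hasSum_moment_one ht)

theorem hasSum_mul_gain (h : IsReducedSolution ℓ T c u) (ht : t ∈ Icc 0 T) :
    HasSum (fun n : ℕ => (n : ℝ) * gain ℓ u n t)
      (2 * moment 2 u t * moment 1 u t - ℓ * moment 1 u t ^ 2) :=
  hasSum_mul_convolution (fun i => mul_nonneg i.cast_nonneg (h.nonneg i t ht))
    (fun i hi => by rw [h.zero_of_le i hi t ht, mul_zero]) (h.hasSum_moment_one ht)
    (h.hasSum_moment_two ht)

/-- Integrated form of the equations, tested against a sequence `φ` of at most linear growth. -/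
theorem hasSum_mul_sub (h : IsReducedSolution ℓ T c u) {φ : ℕ → ℝ}
    (hφ : ∀ n, 1 ≤ n → |φ n| ≤ n) {Γ Λ : ℝ → ℝ}
    (hΓ : ∀ t ∈ Icc 0 T, HasSum (fun n => φ n * gain ℓ u n t) (Γ t))
    (hΛ : ∀ t ∈ Icc 0 T, HasSum (fun n : ℕ => φ n * (n * u n t)) (Λ t)) (ht : t ∈ Icc 0 T) :
    HasSum (fun n => φ n * (u n t - u n 0))
      (∫ s in (0 : ℝ)..t, (Γ s / c s ^ 2 - 2 * Λ s / c s)) := by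
  have hsub : Icc 0 t ⊆ Icc 0 T := Icc_subset_Icc_right ht.2
  have hI : Set.uIoc 0 t ⊆ Icc 0 T := by
    rw [uIoc_of_le ht.1]; exact Ioc_subset_Icc_self.trans hsub
  have hdc : ∀ n : ℕ, ContinuousOn
      (fun s => gain ℓ u n s / c s ^ 2 - 2 * n * u n s / c s) (Icc 0 T) := fun n =>
    ((h.continuousOn_gain n).div (h.continuousOn_coeff.pow 2)
      fun s hs => (pow_pos (h.coeff_pos s hs) 2).ne').sub
      (((h.continuousOn n).const_mul _).div h.continuousOn_coeff
        fun s hs => (h.coeff_pos s hs).ne')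
  have hint : ∀ n, ∫ s in (0 : ℝ)..t, φ n * (gain ℓ u n s / c s ^ 2 - 2 * n * u n s / c s) =
      φ n * (u n t - u n 0) := by
    intro n
    rw [intervalIntegral.integral_const_mul]
    congr 1
    refine intervalIntegral.integral_eq_sub_of_hasDeriv_right_of_le ht.1
      ((h.continuousOn n).mono hsub) (fun s hs => ?_) ?_
    · have hs' : s ∈ Ico 0 T := ⟨hs.1.le, hs.2.trans_le ht.2⟩
      exact (hasDerivWithinAt_Ici_of_Icc (h.hasDeriv n s (Ico_subset_Icc_self hs')) hs').mono
        Ioi_subset_Ici_self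
    · refine ((hdc n).mono ?_).intervalIntegrable
      rwa [uIcc_of_le ht.1]
  simp only [← hint]
  -- The dominating series: gain and loss with their signs made positive and the largest allowed
  -- weight `n`. Its sum is continuous in time because the second moment is.
  have hB : ∀ s ∈ Icc 0 T, HasSum
      (fun n : ℕ => n * gain ℓ u n s / c s ^ 2 + 2 * (n * (n * u n s)) / c s)
      ((2 * moment 2 u s * moment 1 u s - ℓ * moment 1 u s ^ 2) / c s ^ 2 +
        2 * moment 2 u s / c s) := fun s hs =>
    ((h.hasSum_mul_gain hs).div_const _).add (((h.hasSum_moment_two hs).mul_left 2).div_const _)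
  refine intervalIntegral.hasSum_integral_of_dominated_convergence
    (fun n s => n * gain ℓ u n s / c s ^ 2 + 2 * (n * (n * u n s)) / c s) ?_ ?_ ?_ ?_ ?_
  · intro n
    exact (((hdc n).const_mul _).mono hI).aestronglyMeasurable measurableSet_uIoc
  · intro n
    refine Eventually.of_forall fun s hs => ?_
    have hs := hI hs
    have hc := h.coeff_pos s hs
    have hg := h.gain_nonneg n hs
    have hu := h.nonneg n s hs
    -- `φ 0` is unconstrained, but both gain and loss vanish at size `0`.
    rcases Nat.eq_zero_or_pos n with rfl | hn
    · simp [gain_eq_zero_of_le]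
    · calc ‖φ n * (gain ℓ u n s / c s ^ 2 - 2 * n * u n s / c s)‖
          ≤ n * (gain ℓ u n s / c s ^ 2 + 2 * n * u n s / c s) := by
            rw [norm_mul, Real.norm_eq_abs, Real.norm_eq_abs]
            refine mul_le_mul (hφ n hn) ?_ (abs_nonneg _) n.cast_nonneg
            refine (abs_sub _ _).trans ?_
            rw [abs_of_nonneg (by positivity), abs_of_nonneg (by positivity)]
        _ = _ := by ring
  · exact Eventually.of_forall fun s hs => (hB s (hI hs)).summable
  · have hcont : ContinuousOn (fun s => (2 * moment 2 u s * moment 1 u s -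
        ℓ * moment 1 u s ^ 2) / c s ^ 2 + 2 * moment 2 u s / c s) (Icc 0 T) := by
      have h1 := h.continuousOn_moment_one
      have h2 := h.continuousOn_moment_two
      refine ContinuousOn.add (ContinuousOn.div (by fun_prop) (h.continuousOn_coeff.pow 2)
        fun s hs => (pow_pos (h.coeff_pos s hs) 2).ne')
        (ContinuousOn.div (by fun_prop) h.continuousOn_coeff fun s hs => (h.coeff_pos s hs).ne')
    refine (hcont.congr fun s hs => (hB s hs).tsum_eq).mono ?_ |>.intervalIntegrable
    rwa [uIcc_of_le ht.1]
  · refine Eventually.of_forall fun s hs => ?_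
    refine (((hΓ s (hI hs)).div_const (c s ^ 2)).sub
      (((hΛ s (hI hs)).mul_left 2).div_const (c s))).congr_fun fun n => ?_
    ring

theorem moment_one_sub (h : IsReducedSolution ℓ T c u) (ht : t ∈ Icc 0 T) :
    moment 1 u t - moment 1 u 0 = ∫ s in (0 : ℝ)..t,
      ((2 * moment 2 u s * moment 1 u s - ℓ * moment 1 u s ^ 2) / c s ^ 2 -
        2 * moment 2 u s / c s) := by
  have h0 : (0 : ℝ) ∈ Icc 0 T := ⟨le_rfl, ht.1.trans ht.2⟩
  refine HasSum.unique ?_ (h.hasSum_mul_sub (φ := fun n => n) (fun n _ => (Nat.abs_cast n).le)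
    (fun s hs => h.hasSum_mul_gain hs) (fun s hs => h.hasSum_moment_two hs) ht)
  exact ((h.hasSum_moment_one ht).sub (h.hasSum_moment_one h0)).congr_fun fun n => by ring

/-- If the coefficient is the first moment, then the first moment decreases at the rate `ℓ`. -/
theorem moment_one_eq (h : IsReducedSolution ℓ T (moment 1 u) u) (ht : t ∈ Icc 0 T) :
    moment 1 u t = moment 1 u 0 - ℓ * t := by
  have h1 := h.moment_one_sub ht
  rw [intervalIntegral.integral_congr (g := fun _ => -(ℓ : ℝ))] at h1
  · rw [intervalIntegral.integral_const, smul_eq_mul] at h1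
    linarith
  · intro s hs
    rw [uIcc_of_le ht.1] at hs
    have := h.coeff_pos s ⟨hs.1, hs.2.trans ht.2⟩
    field_simp
    ring

/-- If the coefficient decreases at the rate `ℓ` from the initial first moment, then it is the first
moment. -/
theorem moment_one_eq_coeff (h : IsReducedSolution ℓ T c u)
    (hc : ∀ t ∈ Icc 0 T, c t = moment 1 u 0 - ℓ * t) : ∀ t ∈ Icc 0 T, moment 1 u t = c t := by
  intro t ht
  have hT : (0 : ℝ) ∈ Icc 0 T := ⟨le_rfl, ht.1.trans ht.2⟩
  have h1 := h.continuousOn_moment_one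
  have h2 := h.continuousOn_moment_two
  have h3 := h.continuousOn_coeff
  have hc2 : ∀ s ∈ Icc 0 T, c s ^ 2 ≠ 0 := fun s hs => (pow_pos (h.coeff_pos s hs) 2).ne'
  have hG : ContinuousOn (fun s => (2 * moment 2 u s * moment 1 u s -
      ℓ * moment 1 u s ^ 2) / c s ^ 2 - 2 * moment 2 u s / c s) (Icc 0 T) :=
    ContinuousOn.sub (ContinuousOn.div (by fun_prop) (by fun_prop) hc2)
      (ContinuousOn.div (by fun_prop) h3 fun s hs => (h.coeff_pos s hs).ne')
  -- In the derivative of `moment 1 u - c` the numerator over `c ^ 2` is `2 m₂ (m₁ - c) - ℓ (m₁ ^ 2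
  -- - c ^ 2)`, which has the factor `m₁ - c`.
  refine sub_eq_zero.1 (eqOn_zero_of_hasDerivWithinAt_mul
    (w := fun s => moment 1 u s - c s)
    (a := fun s => (2 * moment 2 u s - ℓ * (moment 1 u s + c s)) / c s ^ 2)
    (ContinuousOn.div (by fun_prop) (by fun_prop) hc2) (fun s hs => ?_)
    (by simp [hc 0 hT]) t ht)
  have hd := (hasDerivWithinAt_integral_of_continuousOn hG hs).add
    ((hasDerivWithinAt_id s (Icc 0 T)).const_mul (ℓ : ℝ))
  refine (hd.congr (fun r hr => ?_) ?_).congr_deriv ?_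
  · simp only [Pi.add_apply, id]
    rw [← h.moment_one_sub hr, hc r hr]
    ring
  · simp only [Pi.add_apply, id]
    rw [← h.moment_one_sub hs, hc s hs]
    ring
  · have := h.coeff_pos s hs
    field_simp
    ring

/-- If the coefficient is the first moment, then the number of clusters decreases at unit rate. -/
theorem hasSum_sub_initial (h : IsReducedSolution ℓ T c u)
    (hc : ∀ t ∈ Icc 0 T, moment 1 u t = c t) (ht : t ∈ Icc 0 T) :
    HasSum (fun n => u n t - u n 0) (-t) := by
  have key := h.hasSum_mul_sub (φ := fun _ => 1) (Γ := fun s => c s ^ 2) (Λ := c)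
    (fun n hn => by simpa using hn)
    (fun s hs => by simpa only [one_mul, hc s hs] using h.hasSum_gain hs)
    (fun s hs => by simpa only [one_mul, hc s hs] using h.hasSum_moment_one hs) ht
  rw [intervalIntegral.integral_congr (g := fun _ => -(1 : ℝ))] at key
  · simpa using key
  · intro s hs
    rw [uIcc_of_le ht.1] at hs
    have := h.coeff_pos s ⟨hs.1, hs.2.trans ht.2⟩
    field_simp
    ring

/-- Two reduced solutions with the same coefficient and the same initial data coincide. -/
theorem eqOn {v : ℕ → ℝ → ℝ} (h : IsReducedSolution ℓ T c u) (h' : IsReducedSolution ℓ T c v)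
    (h0 : ∀ n, u n 0 = v n 0) (n : ℕ) : EqOn (u n) (v n) (Icc 0 T) := by
  induction n using Nat.strong_induction_on with
  | _ n ih =>
    -- For `ℓ + 1 ≤ i < n` the partner index `n + ℓ - i` is also below `n`.
    have hg : ∀ t ∈ Icc 0 T, gain ℓ u n t = gain ℓ v n t := fun t ht =>
      Finset.sum_congr rfl fun i hi => by
        rw [Finset.mem_Ico] at hi
        rw [ih i hi.2 ht, ih (n + ℓ - i) (by omega) ht]
    intro t ht
    refine sub_eq_zero.1 (eqOn_zero_of_hasDerivWithinAt_mul (w := fun t => u n t - v n t)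
      (a := fun t => -(2 * n) / c t) (continuousOn_const.div h.continuousOn_coeff
        fun s hs => (h.coeff_pos s hs).ne') (fun s hs => ?_) (by simp [h0]) t ht)
    refine ((h.hasDeriv n s hs).sub (h'.hasDeriv n s hs)).congr_deriv ?_
    rw [hg s hs]
    ring

/-- Reduced solutions with smooth coefficient are smooth. -/
theorem contDiffOn (h : IsReducedSolution ℓ T c u) (hT : 0 < T)
    (hc : ContDiffOn ℝ ∞ c (Icc 0 T)) (n : ℕ) : ContDiffOn ℝ ∞ (u n) (Icc 0 T) := by
  rw [contDiffOn_infty]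
  intro k
  induction k generalizing n with
  | zero => exact contDiffOn_zero.2 (h.continuousOn n)
  | succ k ih =>
    have hU := uniqueDiffOn_Icc hT
    push_cast
    rw [contDiffOn_succ_iff_derivWithin hU]
    refine ⟨fun t ht => (h.hasDeriv n t ht).differentiableWithinAt, by simp, ?_⟩
    have hck : ContDiffOn ℝ k c (Icc 0 T) := contDiffOn_infty.1 hc k
    have hg : ContDiffOn ℝ k (gain ℓ u n) (Icc 0 T) :=
      ContDiffOn.sum fun i _ => (contDiffOn_const.mul (ih i)).mul (contDiffOn_const.mul (ih _))
    refine ((hg.div (hck.pow 2) fun t ht => (pow_pos (h.coeff_pos t ht) 2).ne').sub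
      (((contDiffOn_const (c := 2 * (n : ℝ))).mul (ih n)).div hck fun t ht => (h.coeff_pos t ht).ne')).congr
      fun t ht => ?_
    exact (h.hasDeriv n t ht).derivWithin (hU t ht)

end IsReducedSolution

/-! ### Recursive construction of the reduced solution -/

/-- The solution of the large-cluster equations in which the first moment is replaced by a
prescribed function `c`: the equation for `n`-clusters is linear and involves smaller clusters
only. -/
noncomputable def reducedSolution (ℓ : ℕ) (c : ℝ → ℝ) (u₀ : ℕ → ℝ) (n : ℕ) : ℝ → ℝ :=
  linearSolution (fun s => 2 * n / c s)
    (fun s => (∑ i ∈ (Finset.Ico (ℓ + 1) n).attach,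
      (i.1 : ℝ) * reducedSolution ℓ c u₀ i.1 s *
        (((n + ℓ - i.1 : ℕ) : ℝ) * reducedSolution ℓ c u₀ (n + ℓ - i.1) s)) / c s ^ 2) (u₀ n)
termination_by n
decreasing_by
  all_goals
    have := Finset.mem_Ico.1 i.2
    omega

section ReducedSolution

variable {ℓ : ℕ} {c : ℝ → ℝ} {u₀ : ℕ → ℝ} {T : ℝ}

theorem reducedSolution_eq (ℓ : ℕ) (c : ℝ → ℝ) (u₀ : ℕ → ℝ) (n : ℕ) :
    reducedSolution ℓ c u₀ n = linearSolution (fun s => 2 * n / c s)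
      (fun s => gain ℓ (reducedSolution ℓ c u₀) n s / c s ^ 2) (u₀ n) := by
  rw [reducedSolution]
  congr 1
  funext s
  rw [gain, Finset.sum_attach (Finset.Ico (ℓ + 1) n) fun i =>
    (i : ℝ) * reducedSolution ℓ c u₀ i s *
      (((n + ℓ - i : ℕ) : ℝ) * reducedSolution ℓ c u₀ (n + ℓ - i) s)]

theorem reducedSolution_zero (n : ℕ) : reducedSolution ℓ c u₀ n 0 = u₀ n := by
  rw [reducedSolution_eq, linearSolution_zero]

theorem reducedSolution_of_le (hu₀ : ∀ n ≤ ℓ, u₀ n = 0) {n : ℕ} (hn : n ≤ ℓ) (t : ℝ) :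
    reducedSolution ℓ c u₀ n t = 0 := by
  rw [reducedSolution_eq]
  simp [linearSolution, gain_eq_zero_of_le _ hn, hu₀ n hn]

theorem hasDerivWithinAt_reducedSolution (hc : ContinuousOn c (Icc 0 T))
    (hpos : ∀ t ∈ Icc 0 T, 0 < c t) (n : ℕ) :
    ∀ t ∈ Icc 0 T, HasDerivWithinAt (reducedSolution ℓ c u₀ n)
      (gain ℓ (reducedSolution ℓ c u₀) n t / c t ^ 2 - 2 * n * reducedSolution ℓ c u₀ n t / c t)
      (Icc 0 T) t := by
  induction n using Nat.strong_induction_on with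
  | _ n ih =>
    intro t ht
    have hcont : ∀ m < n, ContinuousOn (reducedSolution ℓ c u₀ m) (Icc 0 T) :=
      fun m hm s hs => (ih m hm s hs).continuousWithinAt
    have hg : ContinuousOn (fun s => gain ℓ (reducedSolution ℓ c u₀) n s / c s ^ 2)
        (Icc 0 T) := by
      refine ContinuousOn.div (continuousOn_finsetSum _ fun i hi => ?_) (hc.pow 2)
        fun s hs => (pow_pos (hpos s hs) 2).ne'
      rw [Finset.mem_Ico] at hi
      exact ((hcont i hi.2).const_mul _).mul ((hcont _ (by omega)).const_mul _)
    have ha : ContinuousOn (fun s => 2 * (n : ℝ) / c s) (Icc 0 T) :=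
      continuousOn_const.div hc fun s hs => (hpos s hs).ne'
    have key := hasDerivWithinAt_linearSolution ha hg (u₀ n) ht
    rw [← reducedSolution_eq] at key
    refine key.congr_deriv ?_
    ring

theorem reducedSolution_nonneg (hu₀ : ∀ n, 0 ≤ u₀ n) (n : ℕ) :
    ∀ t ∈ Icc 0 T, 0 ≤ reducedSolution ℓ c u₀ n t := by
  induction n using Nat.strong_induction_on with
  | _ n ih =>
    intro t ht
    rw [reducedSolution_eq]
    refine linearSolution_nonneg (hu₀ n) (fun s hs => ?_) ht
    refine div_nonneg (Finset.sum_nonneg fun i hi => ?_) (sq_nonneg _)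
    rw [Finset.mem_Ico] at hi
    exact mul_nonneg (mul_nonneg i.cast_nonneg (ih i hi.2 s hs))
      (mul_nonneg (Nat.cast_nonneg _) (ih _ (by omega) s hs))

end ReducedSolution

/-! ### Exponential tails and local existence -/

/-- The profile `A e ^ (μ n) / n ^ 3` with `μ ≤ 0` controls the gain term. -/
theorem gain_le_of_le_exp {ℓ : ℕ} {u : ℕ → ℝ → ℝ} {t A μ : ℝ} (hA : 0 ≤ A) (hμ : μ ≤ 0) {n : ℕ}
    (hn : ℓ + 1 ≤ n) (hu0 : ∀ i < n, 0 ≤ u i t)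
    (hu : ∀ i < n, u i t ≤ A * Real.exp (μ * i) * ((i : ℝ) ^ 3)⁻¹) :
    gain ℓ u n t ≤ 8 * A ^ 2 * Real.exp (μ * n) * ((n : ℝ) ^ 2)⁻¹ := by
  have hb : ∀ i : ℕ, ℓ + 1 ≤ i → i < n →
      (i : ℝ) * u i t ≤ A * Real.exp (μ * i) * ((i : ℝ) ^ 2)⁻¹ := by
    intro i hi hin
    have hi0 : (0 : ℝ) < i := by exact_mod_cast (by omega : 0 < i)
    refine (mul_le_mul_of_nonneg_left (hu i hin) hi0.le).trans_eq ?_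
    field_simp
  have hn0 : (0 : ℝ) < n := by exact_mod_cast (by omega : 0 < n)
  calc gain ℓ u n t
      ≤ ∑ i ∈ Finset.Ico (ℓ + 1) n, A ^ 2 * Real.exp (μ * (n + ℓ : ℕ)) *
          (((i : ℝ) ^ 2)⁻¹ * (((n + ℓ - i : ℕ) : ℝ) ^ 2)⁻¹) := by
        refine Finset.sum_le_sum fun i hi => ?_
        rw [Finset.mem_Ico] at hi
        refine (mul_le_mul (hb i hi.1 hi.2) (hb (n + ℓ - i) (by omega) (by omega))
          (mul_nonneg (Nat.cast_nonneg _) (hu0 _ (by omega))) (by positivity)).trans_eq ?_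
        have e : Real.exp (μ * (n + ℓ : ℕ)) =
            Real.exp (μ * i) * Real.exp (μ * (n + ℓ - i : ℕ)) := by
          rw [← Real.exp_add, ← mul_add, ← Nat.cast_add]
          congr 3
          omega
        rw [e]
        ring
    _ ≤ A ^ 2 * Real.exp (μ * (n + ℓ : ℕ)) * (8 * (((n + ℓ : ℕ) : ℝ) ^ 2)⁻¹) := by
        rw [← Finset.mul_sum]
        exact mul_le_mul_of_nonneg_left (sum_inv_sq_mul_inv_sq_le ℓ n) (by positivity)
    -- As `μ ≤ 0`, the extra `ℓ` in the exponent can only decrease the exponential.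
    _ ≤ A ^ 2 * Real.exp (μ * n) * (8 * ((n : ℝ) ^ 2)⁻¹) := by
        have hle : (n : ℝ) ≤ (n + ℓ : ℕ) := by exact_mod_cast Nat.le_add_right n ℓ
        have he : Real.exp (μ * (n + ℓ : ℕ)) ≤ Real.exp (μ * n) :=
          Real.exp_le_exp.2 (mul_le_mul_of_nonpos_left hle hμ)
        gcongr
    _ = _ := by ring

/-- Exponential decay in the cluster size persists for a short time. -/
theorem le_exp_of_hasDerivWithinAt {ℓ : ℕ} {T A κ δ : ℝ} {c : ℝ → ℝ} {u : ℕ → ℝ → ℝ}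
    (hδ : 0 < δ) (hc : ∀ t ∈ Icc 0 T, δ ≤ c t) (hA : 0 ≤ A) (hκ : 0 ≤ κ)
    (hAκ : 8 * A ≤ κ * δ ^ 2) (hT : κ * T ≤ 1)
    (hzero : ∀ n ≤ ℓ, ∀ t ∈ Icc 0 T, u n t = 0) (hnn : ∀ n, ∀ t ∈ Icc 0 T, 0 ≤ u n t)
    (hd : ∀ n : ℕ, ∀ t ∈ Icc 0 T,
      HasDerivWithinAt (u n) (gain ℓ u n t / c t ^ 2 - 2 * n * u n t / c t) (Icc 0 T) t)
    (h0 : ∀ n : ℕ, ℓ + 1 ≤ n → u n 0 ≤ A * Real.exp (-2 * n) * ((n : ℝ) ^ 3)⁻¹) (n : ℕ) :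
    ∀ t ∈ Icc 0 T, u n t ≤ A * Real.exp ((-2 + κ * t) * n) * ((n : ℝ) ^ 3)⁻¹ := by
  induction n using Nat.strong_induction_on with
  | _ n ih =>
    rcases Nat.lt_or_ge ℓ n with hn | hn
    · have hn0 : (0 : ℝ) < n := by exact_mod_cast (by omega : 0 < n)
      -- Differentiating the profile brings down `κ * n`, turning `1 / n ^ 3` into the `1 / n ^ 2`
      -- of the gain bound. The loss is discarded, and `8 * A ≤ κ * δ ^ 2` compares the constants.
      refine le_of_hasDerivWithinAt_le (hd n)
        (g' := fun t => κ * A * Real.exp ((-2 + κ * t) * n) * ((n : ℝ) ^ 2)⁻¹) (fun t ht => ?_)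
        (by simpa using h0 n hn) fun t ht => ?_
      · have h1 : HasDerivAt (fun t : ℝ => (-2 + κ * t) * n) (κ * n) t := by
          simpa using (((hasDerivAt_id t).const_mul κ).const_add (-2)).mul_const (n : ℝ)
        refine ((h1.exp.const_mul A).mul_const (((n : ℝ) ^ 3)⁻¹)).hasDerivWithinAt.congr_deriv ?_
        field_simp
      · have hct : 0 < c t := hδ.trans_le (hc t ht)
        have hμ : -2 + κ * t ≤ 0 := by
          have := mul_le_mul_of_nonneg_left ht.2 hκ
          linarith
        have hg := gain_le_of_le_exp hA hμ (Nat.succ_le_of_lt hn) (fun i _ => hnn i t ht)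
          (fun i hi => ih i hi t ht)
        have hnn' := hnn n t ht
        have hloss : 0 ≤ 2 * n * u n t / c t := by positivity
        refine (sub_le_self _ hloss).trans ?_
        rw [div_le_iff₀ (by positivity)]
        refine hg.trans ?_
        have hX : 0 ≤ A * Real.exp ((-2 + κ * t) * n) * ((n : ℝ) ^ 2)⁻¹ := by positivity
        have hcδ : 8 * A ≤ κ * c t ^ 2 :=
          hAκ.trans (mul_le_mul_of_nonneg_left (pow_le_pow_left₀ hδ.le (hc t ht) 2) hκ)
        calc 8 * A ^ 2 * Real.exp ((-2 + κ * t) * n) * ((n : ℝ) ^ 2)⁻¹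
            = (8 * A) * (A * Real.exp ((-2 + κ * t) * n) * ((n : ℝ) ^ 2)⁻¹) := by ring
          _ ≤ (κ * c t ^ 2) * (A * Real.exp ((-2 + κ * t) * n) * ((n : ℝ) ^ 2)⁻¹) :=
            mul_le_mul_of_nonneg_right hcδ hX
          _ = _ := by ring
    · intro t ht
      rw [hzero n hn t ht]
      positivity

/-- Weierstrass M-test with the majorant `A * exp (-n)`. -/
theorem momentConvergesUniformly_two_of_le_exp {T A : ℝ} {u : ℕ → ℝ → ℝ} (hA : 0 ≤ A)
    (hnn : ∀ n, ∀ t ∈ Icc 0 T, 0 ≤ u n t)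
    (hu : ∀ n : ℕ, ∀ t ∈ Icc 0 T, u n t ≤ A * Real.exp (-n) * ((n : ℝ) ^ 3)⁻¹) :
    MomentConvergesUniformly 2 T u := by
  refine tendstoUniformlyOn_tsum_nat (u := fun n : ℕ => A * Real.exp (-n))
    (Real.summable_exp_neg_nat.mul_left A) fun n t ht => ?_
  rw [Real.norm_of_nonneg (mul_nonneg (by positivity) (hnn n t ht))]
  rcases Nat.eq_zero_or_pos n with rfl | hn
  · simpa using hA
  · have hn1 : (1 : ℝ) ≤ n := by exact_mod_cast hn
    have hn0 : (0 : ℝ) < n := by linarith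
    calc (n : ℝ) ^ 2 * u n t ≤ n ^ 2 * (A * Real.exp (-n) * ((n : ℝ) ^ 3)⁻¹) :=
          mul_le_mul_of_nonneg_left (hu n t ht) (by positivity)
      _ = A * Real.exp (-n) * (n : ℝ)⁻¹ := by field_simp
      _ ≤ A * Real.exp (-n) := mul_le_of_le_one_right (by positivity) (inv_le_one_of_one_le₀ hn1)

/-- Local existence for the large-cluster equations in which the first moment is replaced by the
affine function that it has to be. -/
theorem exists_isReducedSolution (ℓ : ℕ) {u₀ : ℕ → ℝ} (hu₀ : ∀ n, 0 ≤ u₀ n)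
    (hzero : ∀ n ≤ ℓ, u₀ n = 0) {L : ℕ} (hL : ∀ n, L < n → u₀ n = 0) {m : ℝ} (hm : 0 < m) :
    ∃ T : ℝ, 0 < T ∧ ∃ u : ℕ → ℝ → ℝ,
      IsReducedSolution ℓ T (fun t => m - ℓ * t) u ∧ ∀ n, u n 0 = u₀ n := by
  obtain ⟨A, hA, hA0⟩ : ∃ A : ℝ, 0 < A ∧
      ∀ n : ℕ, ℓ + 1 ≤ n → u₀ n ≤ A * Real.exp (-2 * n) * ((n : ℝ) ^ 3)⁻¹ := by
    have hterm : ∀ n : ℕ, 0 ≤ u₀ n * (Real.exp (2 * n) * (n : ℝ) ^ 3) := fun n =>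
      mul_nonneg (hu₀ n) (by positivity)
    -- Bounded support makes the sum finite; the summand `1` keeps `A`, and hence `κ`, positive.
    refine ⟨1 + ∑ n ∈ Finset.range (L + 1), u₀ n * (Real.exp (2 * n) * (n : ℝ) ^ 3),
      add_pos_of_pos_of_nonneg one_pos (Finset.sum_nonneg fun n _ => hterm n), fun n hn => ?_⟩
    have hn0 : (0 : ℝ) < n := by exact_mod_cast (by omega : 0 < n)
    have key : u₀ n * (Real.exp (2 * n) * (n : ℝ) ^ 3) ≤
        1 + ∑ n ∈ Finset.range (L + 1), u₀ n * (Real.exp (2 * n) * (n : ℝ) ^ 3) := by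
      rcases Nat.lt_or_ge L n with h | h
      · rw [hL n h, zero_mul]
        exact add_nonneg zero_le_one (Finset.sum_nonneg fun n _ => hterm n)
      · have := Finset.single_le_sum (fun i _ => hterm i)
          (Finset.mem_range.2 (Nat.lt_succ_of_le h))
        linarith
    rw [neg_mul, Real.exp_neg, mul_assoc, ← mul_inv, ← div_eq_mul_inv,
      le_div_iff₀ (by positivity)]
    exact key
  -- Equality in `8 * A ≤ κ * δ ^ 2` with `δ = m / 2`. The bounds on `T` below ensure `κ * T ≤ 1`,
  -- so the decay rate stays at least `1`, and `ℓ * T ≤ m / 2`, so the coefficient stays above `δ`.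
  set κ : ℝ := 8 * A / (m / 2) ^ 2 with hκ
  have hκ0 : 0 < κ := by positivity
  set T : ℝ := min κ⁻¹ (m / (2 * (ℓ + 1))) with hT
  have hT0 : 0 < T := lt_min (by positivity) (by positivity)
  set c : ℝ → ℝ := fun t => m - ℓ * t with hc
  have hcc : ContinuousOn c (Icc 0 T) := by fun_prop
  have hcδ : ∀ t ∈ Icc 0 T, m / 2 ≤ c t := by
    intro t ht
    have h1 : t ≤ m / (2 * (ℓ + 1)) := ht.2.trans (min_le_right _ _)
    rw [le_div_iff₀ (by positivity)] at h1
    have := ht.1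
    simp only [hc]
    linarith
  have hcpos : ∀ t ∈ Icc 0 T, 0 < c t := fun t ht => (half_pos hm).trans_le (hcδ t ht)
  have hκT : κ * T ≤ 1 :=
    (mul_le_mul_of_nonneg_left (min_le_left _ _) hκ0.le).trans_eq (mul_inv_cancel₀ hκ0.ne')
  have hz : ∀ n ≤ ℓ, ∀ t ∈ Icc 0 T, reducedSolution ℓ c u₀ n t = 0 :=
    fun n hn t _ => reducedSolution_of_le hzero hn t
  have hnn : ∀ n, ∀ t ∈ Icc 0 T, 0 ≤ reducedSolution ℓ c u₀ n t := reducedSolution_nonneg hu₀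
  have hd := fun n => hasDerivWithinAt_reducedSolution (ℓ := ℓ) (u₀ := u₀) hcc hcpos n
  have hbound := le_exp_of_hasDerivWithinAt (half_pos hm) hcδ hA.le hκ0.le
    (by rw [hκ, div_mul_cancel₀ _ (by positivity)]) hκT hz hnn hd
    (fun n hn => by rw [reducedSolution_zero]; exact hA0 n hn)
  refine ⟨T, hT0, reducedSolution ℓ c u₀, ⟨hz, hnn, ?_, hcc, hcpos, hd⟩, reducedSolution_zero⟩
  refine momentConvergesUniformly_two_of_le_exp hA.le hnn fun n t ht => (hbound n t ht).trans ?_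
  have h1 : κ * t ≤ 1 := (mul_le_mul_of_nonneg_left ht.2 hκ0.le).trans hκT
  have h2 : (-2 + κ * t) * n ≤ -n := by
    have : (0 : ℝ) ≤ n := n.cast_nonneg
    nlinarith
  gcongr

/-! ### Return to the large-cluster and full kinetic equations -/

namespace IsReducedSolution

variable {ℓ : ℕ} {T : ℝ} {c : ℝ → ℝ} {u : ℕ → ℝ → ℝ} {t : ℝ}

/-- The restriction on pairs costs nothing: if the sizes add up to at most `ℓ`, both fractions
vanish. The double series is then a product. -/
theorem hasSum_collisionTerm (h : IsReducedSolution ℓ T c u) (ht : t ∈ Icc 0 T) :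
    HasSum (collisionTerm ℓ u t) (moment 1 u t ^ 2) := by
  have hb0 : ∀ i : ℕ, 0 ≤ (i : ℝ) * u i t := fun i => mul_nonneg i.cast_nonneg (h.nonneg i t ht)
  have h1 := h.hasSum_moment_one ht
  rw [pow_two]
  refine (h1.mul h1 (h1.summable.mul_of_nonneg h1.summable hb0 hb0)).congr_fun fun p => ?_
  rw [collisionTerm]
  split_ifs with hp
  · ring
  · rw [h.zero_of_le p.1 (by omega) t ht]
    ring

theorem kineticRHS_eq (h : IsReducedSolution ℓ T c u)
    (hc : ∀ t ∈ Icc 0 T, moment 1 u t = c t) {n : ℕ} (hn : 1 ≤ n) (ht : t ∈ Icc 0 T) :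
    kineticRHS ℓ u n t = gain ℓ u n t / c t ^ 2 - 2 * n * u n t / c t := by
  have hM : collisionMass ℓ u t = c t ^ 2 := by
    rw [collisionMass, (h.hasSum_collisionTerm ht).tsum_eq, hc t ht]
  rw [kineticRHS, hM]
  congr 1
  · rw [gain, Finset.sum_div]
    symm
    refine Finset.sum_subset_zero_on_sdiff (fun i hi => ?_) (fun i hi => ?_) fun i _ => by ring
    · simp only [Finset.mem_Icc, Finset.mem_Ico] at *
      omega
    · simp only [Finset.mem_sdiff, Finset.mem_Icc, Finset.mem_Ico, not_and, not_lt] at hi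
      by_cases hi' : i ≤ ℓ
      · rw [h.zero_of_le i hi' t ht]
        ring
      · rw [h.zero_of_le (n + ℓ - i) (by have := hi.2 (by omega); omega) t ht, mul_zero]
  -- The lower cutoff in the loss sum matters only for `n ≤ ℓ`, where the prefactor `u n t` is zero.
  · by_cases hnℓ : n ≤ ℓ
    · rw [h.zero_of_le n hnℓ t ht]
      ring
    · have hmax : max (1 + ℓ - n) 1 = 1 := by omega
      have hs : HasSum (fun i : ℕ => if max (1 + ℓ - n) 1 ≤ i then (i : ℝ) * u i t / c t ^ 2 else 0)
          (c t / c t ^ 2) := by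
        rw [← hc t ht]
        refine ((h.hasSum_moment_one ht).div_const _).congr_fun fun i => ?_
        rw [hmax]
        split_ifs with hi
        · rfl
        · rw [show i = 0 by omega]
          simp
      rw [hs.tsum_eq]
      have := h.coeff_pos t ht
      field_simp

theorem isLargeClusterSolution (h : IsReducedSolution ℓ T c u) (hT : 0 < T)
    (hsmooth : ContDiffOn ℝ ∞ c (Icc 0 T)) (hc : ∀ t ∈ Icc 0 T, moment 1 u t = c t)
    {u₀ : ℕ → ℝ} (h0 : ∀ n, u n 0 = u₀ n) (hsum : HasSum u₀ 1) :
    IsLargeClusterSolution ℓ u₀ T u where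
  zero_of_le := h.zero_of_le
  contDiffOn n _ := contDiffOn_infty.1 (h.contDiffOn hT hsmooth n) 1
  mapsTo n _ t ht := by
    refine ⟨h.nonneg n t ht, ?_⟩
    -- The fractions sum to `1 - t`, so each nonnegative one is at most `1`.
    have hs : HasSum (fun n => u n t) (-t + 1) :=
      ((h.hasSum_sub_initial hc ht).add hsum).congr_fun fun n => by rw [h0]; ring
    have := le_hasSum hs n fun i _ => h.nonneg i t ht
    have := ht.1
    linarith
  summable_mass t ht := (h.hasSum_moment_one ht).summable
  mass_pos t ht := by rw [hc t ht]; exact h.coeff_pos t ht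
  hasDeriv n _ t ht := by
    rw [largeRHS_eq, hc t ht]
    exact h.hasDeriv n t ht
  init n _ := h0 n

theorem isPreGelationSolution (h : IsReducedSolution ℓ T c u)
    (hc : ∀ t ∈ Icc 0 T, moment 1 u t = c t) {u₀ : ℕ → ℝ} (h0 : ∀ n, u n 0 = u₀ n) :
    IsPreGelationSolution ℓ u₀ T u where
  isSolution :=
    { nonneg := fun n _ => h.nonneg n
      summable_mass := fun t ht => (h.hasSum_moment_one ht).summable
      summable_collision := fun t ht => (h.hasSum_collisionTerm ht).summable
      collisionMass_pos := fun t ht => by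
        rw [collisionMass, (h.hasSum_collisionTerm ht).tsum_eq, hc t ht]
        exact pow_pos (h.coeff_pos t ht) 2
      hasDeriv := fun n hn t ht => by
        rw [h.kineticRHS_eq hc hn ht]
        exact h.hasDeriv n t ht
      init := fun n _ => h0 n }
  secondMoment := h.secondMoment

end IsReducedSolution

theorem IsLargeClusterSolution.isReducedSolution {ℓ : ℕ} {u₀ : ℕ → ℝ} {T : ℝ} {v : ℕ → ℝ → ℝ}
    (h : IsLargeClusterSolution ℓ u₀ T v) (h2 : MomentConvergesUniformly 2 T v) :
    IsReducedSolution ℓ T (moment 1 v) v := by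
  have hnn : ∀ n : ℕ, ∀ t ∈ Icc 0 T, 0 ≤ v n t := by
    intro n t ht
    rcases Nat.lt_or_ge ℓ n with hn | hn
    · exact (h.mapsTo n hn ht).1
    · exact (h.zero_of_le n hn t ht).ge
  have hd : ∀ n : ℕ, ∀ t ∈ Icc 0 T, HasDerivWithinAt (v n)
      (gain ℓ v n t / moment 1 v t ^ 2 - 2 * n * v n t / moment 1 v t) (Icc 0 T) t := by
    intro n t ht
    rcases Nat.lt_or_ge ℓ n with hn | hn
    · rw [← largeRHS_eq]
      exact h.hasDeriv n hn t ht
    · rw [gain_eq_zero_of_le v hn, h.zero_of_le n hn t ht]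
      refine ((hasDerivWithinAt_const t (Icc 0 T) (0 : ℝ)).congr (h.zero_of_le n hn)
        (h.zero_of_le n hn t ht)).congr_deriv ?_
      simp
  exact ⟨h.zero_of_le, hnn, h2, (h2.first_of_second hnn).continuousOn
    fun n t ht => (hd n t ht).continuousWithinAt, h.mass_pos, hd⟩

end EmissionCoagulation

theorem theorem3p5 (ℓ : ℕ) (hℓ : 1 ≤ ℓ) (u₀ : ℕ → ℝ)
    (h_nonneg : ∀ n : ℕ, 0 ≤ u₀ n) (h_sum : HasSum u₀ 1)
    (h_large : ∀ n : ℕ, n ≤ ℓ → u₀ n = 0)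
    (L : ℕ) (hL : ℓ + 1 ≤ L) (h_bdd : ∀ n : ℕ, L < n → u₀ n = 0) :
    ∃ T : ℝ, 0 < T ∧ ∃ u : ℕ → ℝ → ℝ,
      EmissionCoagulation.IsLargeClusterSolution ℓ u₀ T u ∧
      EmissionCoagulation.IsPreGelationSolution ℓ u₀ T u ∧
      (∀ n : ℕ, ℓ + 1 ≤ n → ContDiffOn ℝ ∞ (u n) (Icc 0 T)) ∧
      ∀ v : ℕ → ℝ → ℝ,
        EmissionCoagulation.IsLargeClusterSolution ℓ u₀ T v →
        EmissionCoagulation.MomentConvergesUniformly 2 T v →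
        ∀ n : ℕ, ℓ + 1 ≤ n → EqOn (v n) (u n) (Icc 0 T) := by
  have hmass : Summable fun i : ℕ => (i : ℝ) ^ 1 * u₀ i :=
    summable_of_ne_finset_zero (s := Finset.range (L + 1)) fun i hi => by
      rw [h_bdd i (by simpa [Nat.lt_succ_iff] using hi), mul_zero]
  have hm : 0 < ∑' i : ℕ, (i : ℝ) ^ 1 * u₀ i := by
    obtain ⟨n, hn⟩ : ∃ n, u₀ n ≠ 0 := by
      by_contra! h
      exact one_ne_zero (h_sum.unique (funext h ▸ hasSum_zero : HasSum u₀ (0 : ℝ)))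
    have hn0 : 0 < n := Nat.pos_of_ne_zero fun h => hn (h_large n (by omega))
    exact hmass.tsum_pos (fun i => mul_nonneg (by positivity) (h_nonneg i)) n
      (mul_pos (by positivity) ((h_nonneg n).lt_of_ne' hn))
  obtain ⟨T, hT, u, hu, hu0⟩ :=
    EmissionCoagulation.exists_isReducedSolution ℓ h_nonneg h_large h_bdd hm
  have hsmooth : ContDiffOn ℝ ∞ (fun t : ℝ => (∑' i : ℕ, (i : ℝ) ^ 1 * u₀ i) - ℓ * t) (Icc 0 T) :=
    ContDiff.contDiffOn (by fun_prop)
  have hc := hu.moment_one_eq_coeff fun t _ => by simp only [EmissionCoagulation.moment, hu0]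
  refine ⟨T, hT, u, hu.isLargeClusterSolution hT hsmooth hc hu0 h_sum,
    hu.isPreGelationSolution hc hu0, fun n _ => hu.contDiffOn hT hsmooth n,
    fun v hv hv2 n _ => ?_⟩
  have hvr := hv.isReducedSolution hv2
  have hv0 : ∀ n, v n 0 = u₀ n := by
    intro n
    rcases Nat.lt_or_ge ℓ n with hn | hn
    · exact hv.init n hn
    · rw [hv.zero_of_le n hn 0 ⟨le_rfl, hT.le⟩, h_large n hn]
  have hvc : ∀ t ∈ Icc 0 T, EmissionCoagulation.moment 1 v t = (∑' i : ℕ, (i : ℝ) ^ 1 * u₀ i) - ℓ * t := by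
    intro t ht
    rw [hvr.moment_one_eq ht]
    simp only [EmissionCoagulation.moment, hv0]
  -- The first moment of `v` is forced to be the same affine function, so `v` and `u` solve one
  -- triangular system.
  have hvr' : EmissionCoagulation.IsReducedSolution ℓ T
      (fun t => (∑' i : ℕ, (i : ℝ) ^ 1 * u₀ i) - ℓ * t) v :=
    ⟨hvr.zero_of_le, hvr.nonneg, hv2, hu.continuousOn_coeff, hu.coeff_pos,
      fun n t ht => by simpa only [hvc t ht] using hvr.hasDeriv n t ht⟩
  exact hvr'.eqOn hu (fun n => by rw [hv0, hu0]) n
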